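/- Let $R$ be a commutative ring, $n\ge 1$ an integer, $\mu=(\mu_1\ge\mu_2\ge\dots\ge\mu_n\ge 0)$ a partition of length $\ell(\mu)\le n$, $m=\mu_1+n$, and $\lambda=\mu+(n,n-1,\dots,1)$, i.e. $\lambda_i=\mu_i+n+1-i$. Let $t\in R$, $z=(z_1,\dots,z_n)\in R^n$ and $\alpha=(\alpha_1,\alpha_2,\dots)$ a sequence in $R$ (in particular these may all be independent indeterminates). Consider the planar grid with $n$ rows (numbered from top to bottom) and $m$ columns (numbered from left to right). A state $\mathfrak s$ assigns to every edge, internal or external, a spin, up ($+$) or down ($-$), such that: * the external spins are fixed as follows: all edges on the left boundary are $-$, all edges on the right boundary are $+$, all edges on the top boundary are $+$, and the bottom boundary edge of column $j$ is $-$ if $j\in\{\lambda_1,\dots,\lambda_n\}$ and $+$ otherwise; * each vertex is of one of the six types in the following table, which gives the spins on its north, south, west and east edges (in this order), and the Boltzmann weight $\beta_{ij}$ that the vertex carries when it is in row $i$ and column $j$: $$\begin{array}{|c|c|c|c|c|c|c|}\hline \text{type} & \mathrm{WE} & \mathrm{NS} & \mathrm{NE} & \mathrm{SE} & \mathrm{NW}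 & \mathrm{SW}\\ \hline (\mathrm{north},\mathrm{south},\mathrm{west},\mathrm{east}) & (+,-,-,+) & (-,+,+,-) & (-,-,+,+) & (+,+,+,+) & (-,-,-,-) & (+,+,-,-)\\ \hline \beta_{ij} & 1 & (1+t)z_i & t & 1 & z_i-t\alpha_j & z_i+\alpha_j\\ \hline \end{array}$$ Let $\mathfrak S_{\mu,t}^{\Gamma}$ be the set of all such states and let $$Z(\mathfrak S_{\mu,t}^{\Gamma})=\sum_{\mathfrak s\in\mathfrak S_{\mu,t}^{\Gamma}}\ \prod_{i=1}^n\prod_{j=1}^m\beta_{ij}$$ be the partition function. Let $$s_\mu(z\,|\,\alpha)=\sum_{T}\ \prod_{(i,j)\in F^\mu}\bigl(z_{T_{ij}}+\alpha_{T_{ij}+j-i}\bigr)$$ be the factorial Schur function, where $F^\mu=\{(i,j): 1\le j\le\mu_i\}$ is the Young diagram of $\mu$ and $T$ runs over the semistandard tableaux of shape $\mu$ with entries in $\{1,\dots,n\}$ (weakly increasing along rows, strictly increasing down columns). Then $$Z(\mathfrak S_{\mu,t}^{\Gamma})=\prod_{1\le i<j\le n}(t z_i+z_j)\ \, s_\mu(z\,|\,\alpha).$$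 -/

import Mathlib

/-- The two spin states an edge can carry. -/
inductive Spin : Type
  | up : Spin
  | down : Spin
  deriving DecidableEq

instance Spin.instFintype : Fintype Spin where
  elems := {Spin.up, Spin.down}
  complete s := by cases s <;> simp

/-- An assignment of spins to all the edges, internal and external, of the planar grid with `n` rows
and `m` columns. Rows are numbered from top to bottom and columns from left to right
(both starting from `0` here). The vertex `(i, j)` has northern edge `vert i j`, southern edge
`vert (i + 1) j`, western edge `horiz i j` and eastern edge `horiz i (j + 1)`. -/
structure SpinConfig (n m : ℕ) : Type where
  vert : Fin (n + 1) → Fin m → Spin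
  horiz : Fin n → Fin (m + 1) → Spin

/-- A spin configuration is a pair of functions, on the vertical and on the horizontal edges. -/
def SpinConfig.equivProd (n m : ℕ) :
    ((Fin (n + 1) → Fin m → Spin) × (Fin n → Fin (m + 1) → Spin)) ≃ SpinConfig n m where
  toFun p := ⟨p.1, p.2⟩
  invFun s := (s.vert, s.horiz)
  left_inv _ := rfl
  right_inv _ := rfl

instance SpinConfig.instFintype (n m : ℕ) : Fintype (SpinConfig n m) :=
  Fintype.ofEquiv _ (SpinConfig.equivProd n m)

namespace SpinConfig

variable {n m : ℕ}

/-- The spin on the edge to the north of the vertex `(i, j)`. -/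
def north (s : SpinConfig n m) (i : Fin n) (j : Fin m) : Spin := s.vert i.castSucc j

/-- The spin on the edge to the south of the vertex `(i, j)`. -/
def south (s : SpinConfig n m) (i : Fin n) (j : Fin m) : Spin := s.vert i.succ j

/-- The spin on the edge to the west of the vertex `(i, j)`. -/
def west (s : SpinConfig n m) (i : Fin n) (j : Fin m) : Spin := s.horiz i j.castSucc

/-- The spin on the edge to the east of the vertex `(i, j)`. -/
def east (s : SpinConfig n m) (i : Fin n) (j : Fin m) : Spin := s.horiz i j.succ

end SpinConfig

/-- The six admissible vertices, named by compass points. -/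
inductive VertexType : Type
  | WE : VertexType
  | NS : VertexType
  | NE : VertexType
  | SE : VertexType
  | NW : VertexType
  | SW : VertexType
  deriving DecidableEq

/-- The type of a vertex whose northern, southern, western and eastern edges carry the given spins;
`none` for the ten arrangements of spins that the six-vertex model does not allow. -/
def vertexType : (north south west east : Spin) → Option VertexType
  | .up, .down, .down, .up => some .WE
  | .down, .up, .up, .down => some .NS
  | .down, .down, .up, .up => some .NE
  | .up, .up, .up, .up => some .SE
  | .down, .down, .down, .down => some .NW
  | .up, .up, .down, .down => some .SW
  | _, _, _, _ => none

/-- The Boltzmann weight of a vertex of a given type, for the row parameter `zi`, the column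
parameter `αj` and the deformation parameter `t`. -/
def boltzmannWeight {R : Type*} [CommRing R] (t zi αj : R) : VertexType → R
  | .WE => 1
  | .NS => (1 + t) * zi
  | .NE => t
  | .SE => 1
  | .NW => zi - t * αj
  | .SW => zi + αj

/-- `j` (with `1 ≤ j`) is a part of the strict partition `λ = μ + (n, n - 1, …, 1)`, that is
`j = μ_{i+1} + (n - i)` for some `0 ≤ i < n`, where `μ_{i+1} = μ.rowLen i`. -/
def IsShiftedPart (μ : YoungDiagram) (n j : ℕ) : Prop :=
  ∃ i : Fin n, j = μ.rowLen i + (n - (i : ℕ))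

instance (μ : YoungDiagram) (n j : ℕ) : Decidable (IsShiftedPart μ n j) := by
  unfold IsShiftedPart; infer_instance

/-- The external spins determined by `μ`: all external edges at the top and on the right are up, all
those on the left are down, and the one below column `j` is down if `j` is a part of
`λ = μ + (n, n - 1, …, 1)` and up otherwise (columns are numbered from `1` in `λ`). -/
def HasBoundary (μ : YoungDiagram) {n m : ℕ} (s : SpinConfig n m) : Prop :=
  (∀ j : Fin m, s.vert 0 j = Spin.up) ∧
  (∀ i : Fin n, s.horiz i 0 = Spin.down) ∧
  (∀ i : Fin n, s.horiz i (Fin.last m) = Spin.up) ∧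
  (∀ j : Fin m, s.vert (Fin.last n) j =
    if IsShiftedPart μ n ((j : ℕ) + 1) then Spin.down else Spin.up)

/-- Every vertex is of one of the six types. -/
def IsSixVertex {n m : ℕ} (s : SpinConfig n m) : Prop :=
  ∀ (i : Fin n) (j : Fin m),
    (vertexType (s.north i j) (s.south i j) (s.west i j) (s.east i j)).isSome = true

instance (μ : YoungDiagram) {n m : ℕ} (s : SpinConfig n m) : Decidable (HasBoundary μ s) := by
  unfold HasBoundary; infer_instance

instance {n m : ℕ} (s : SpinConfig n m) : Decidable (IsSixVertex s) := by
  unfold IsSixVertex; infer_instance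

/-- The Boltzmann weight of the vertex `(i, j)` of a spin configuration, where `α k` stands for
`α_k`, `k ≥ 1` (so that the column `j`, counted from `0`, carries `α_{j+1}`). The value `0` for an
arrangement of spins that is not allowed is never used below. -/
def SpinConfig.weightAt {R : Type*} [CommRing R] {n m : ℕ} (s : SpinConfig n m)
    (t : R) (z : Fin n → R) (α : ℕ → R) (i : Fin n) (j : Fin m) : R :=
  ((vertexType (s.north i j) (s.south i j) (s.west i j) (s.east i j)).map
    (boltzmannWeight t (z i) (α ((j : ℕ) + 1)))).getD 0

/-- The set of states of the model with `n` rows and `μ_1 + n` columns: the six-vertex spin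
configurations with the external spins determined by `μ`. -/
def sixVertexStates (μ : YoungDiagram) (n : ℕ) : Finset (SpinConfig n (μ.rowLen 0 + n)) :=
  Finset.univ.filter fun s => HasBoundary μ s ∧ IsSixVertex s

/-- The partition function: the sum over all states of the product of the Boltzmann weights of all
the vertices. -/
def partitionFunction {R : Type*} [CommRing R] (μ : YoungDiagram) (n : ℕ)
    (t : R) (z : Fin n → R) (α : ℕ → R) : R :=
  ∑ s ∈ sixVertexStates μ n, ∏ i : Fin n, ∏ j : Fin (μ.rowLen 0 + n), s.weightAt t z α i j

/-- Semistandard Young tableaux of shape `μ` with entries in an alphabet of `n` letters, here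
`0 < 1 < ⋯ < n - 1`. -/
def BoundedSSYT (μ : YoungDiagram) (n : ℕ) : Type :=
  {T : SemistandardYoungTableau μ // ∀ i j : ℕ, (i, j) ∈ μ → T i j < n}

instance BoundedSSYT.instFinite (μ : YoungDiagram) (n : ℕ) : Finite (BoundedSSYT μ n) := by
  refine Finite.of_injective (β := μ.cells → Fin n)
    (fun T c => ⟨T.1 c.1.1 c.1.2, T.2 _ _ ((YoungDiagram.mem_cells _).1 c.2)⟩) ?_
  intro T T' h
  apply Subtype.ext
  ext i j
  by_cases hc : (i, j) ∈ μ
  · have := congrFun h ⟨(i, j), (YoungDiagram.mem_cells _).2 hc⟩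
    simpa using this
  · rw [T.1.zeros hc, T'.1.zeros hc]

noncomputable instance BoundedSSYT.instFintype (μ : YoungDiagram) (n : ℕ) :
    Fintype (BoundedSSYT μ n) := Fintype.ofFinite _

/-- The entry (as an element of `Fin n`) of a tableau in a cell of its shape. -/
def BoundedSSYT.entry {μ : YoungDiagram} {n : ℕ} (T : BoundedSSYT μ n) (c : μ.cells) : Fin n :=
  ⟨T.1 c.1.1 c.1.2, T.2 _ _ ((YoungDiagram.mem_cells _).1 c.2)⟩

/-- The factorial Schur function `s_μ(z | α) = ∑_T ∏_{(i,j)} (z_{T(i,j)} + α_{T(i,j) + j - i})`, the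
sum over the semistandard tableaux of shape `μ` with entries in `{1, …, n}`; `α k` stands for `α_k`.
With rows, columns and entries counted from `0`, the index of `α` is `T(i,j) + j + 1 - i`. The
subtraction does not truncate: the entries in row `i` of a semistandard tableau are at least `i`. -/
noncomputable def factorialSchur {R : Type*} [CommRing R] (μ : YoungDiagram) {n : ℕ}
    (z : Fin n → R) (α : ℕ → R) : R :=
  ∑ T : BoundedSSYT μ n, ∏ c : μ.cells,
    (z (T.entry c) + α ((T.entry c : ℕ) + c.1.2 + 1 - c.1.1))

theorem Fin.sum_univ_pi_snoc {S M : Type*} [Fintype S] [AddCommMonoid M] {m : ℕ}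
    (F : (Fin (m + 1) → S) → M) :
    ∑ u, F u = ∑ s, ∑ u : Fin m → S, F (Fin.snoc u s) := by
  rw [← (Fin.snocEquiv fun _ : Fin (m + 1) => S).sum_comp, Fintype.sum_prod_type]
  rfl

theorem Spin.sum_univ {M : Type*} [AddCommMonoid M] (F : Spin → M) :
    ∑ s, F s = F Spin.up + F Spin.down := by
  have : (Finset.univ : Finset Spin) = {Spin.up, Spin.down} := rfl
  rw [this, Finset.sum_pair (by decide)]

/-- The ordered product of the elements `c j` over the positions `j` of the down spins. -/
def spinProd {A : Type*} [Monoid A] (c : ℕ → A) {m : ℕ} (u : Fin m → Spin) : A :=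
  (List.ofFn fun j : Fin m => if u j = Spin.down then c j else 1).prod

theorem spinProd_snoc {A : Type*} [Monoid A] (c : ℕ → A) {m : ℕ} (u : Fin m → Spin) (s : Spin) :
    spinProd c (Fin.snoc u s : Fin (m + 1) → Spin) =
      spinProd c u * if s = Spin.down then c m else 1 := by
  rw [spinProd, List.ofFn_succ', List.prod_concat]
  simp [spinProd]

theorem spinProd_zero {A : Type*} [Monoid A] (c : ℕ → A) (u : Fin 0 → Spin) :
    spinProd c u = 1 := by
  simp [spinProd]

/-- The weight of a vertex in column `j` (counted from `0`), as a function of the four spins. -/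
def siteWeight {R : Type*} [CommRing R] (t w : R) (α : ℕ → R) (j : ℕ) (n s we ea : Spin) : R :=
  ((vertexType n s we ea).map (boltzmannWeight t w (α (j + 1)))).getD 0

/-- The partition function of one row with northern spins `u`, southern spins `v`,
westernmost spin down and easternmost spin `e`. -/
def rowWeight {R : Type*} [CommRing R] (t w : R) (α : ℕ → R) {m : ℕ} (u v : Fin m → Spin)
    (e : Spin) : R :=
  ∑ h : Fin (m + 1) → Spin, if h 0 = Spin.down ∧ h (Fin.last m) = e then
    ∏ j : Fin m, siteWeight t w α j (u j) (v j) (h j.castSucc) (h j.succ) else 0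

theorem rowWeight_zero {R : Type*} [CommRing R] (t w : R) (α : ℕ → R) (u v : Fin 0 → Spin)
    (e : Spin) : rowWeight t w α u v e = if e = Spin.down then 1 else 0 := by
  rw [rowWeight, Fin.sum_univ_pi_snoc]
  rw [Spin.sum_univ]
  cases e <;> simp [Fin.snoc]

theorem rowWeight_snoc {R : Type*} [CommRing R] (t w : R) (α : ℕ → R) {m : ℕ}
    (u v : Fin m → Spin) (a b e : Spin) :
    rowWeight t w α (Fin.snoc u a : Fin (m + 1) → Spin) (Fin.snoc v b : Fin (m + 1) → Spin) e =
      ∑ e', rowWeight t w α u v e' * siteWeight t w α m a b e' e := by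
  rw [rowWeight, Fin.sum_univ_pi_snoc, Fintype.sum_eq_single e]
  · simp only [rowWeight, Finset.sum_mul]
    rw [Finset.sum_comm]
    refine Finset.sum_congr rfl fun h _ => ?_
    rw [Fintype.sum_eq_single (h (Fin.last m))]
    · have h0 : (Fin.snoc h e : Fin (m + 2) → Spin) 0 = h 0 := by
        rw [← Fin.castSucc_zero, Fin.snoc_castSucc]
      simp only [h0, Fin.snoc_last, and_true, Fin.prod_univ_castSucc, Fin.snoc_castSucc,
        Fin.succ_last, Fin.succ_castSucc, Fin.val_castSucc, Fin.val_last]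
      split_ifs <;> simp
    · intro x hx
      simp [hx.symm]
  · intro x hx
    simp [hx]

/-- The sum over the northern spins `u` of the row weight times the product of the `c j` over the
down spins of `u`. -/
noncomputable def rowSum {R : Type*} [CommRing R] {A : Type*} [Ring A] [Algebra R A] (t w : R)
    (α : ℕ → R) (c : ℕ → A) (e : Spin) {m : ℕ} (v : Fin m → Spin) : A :=
  ∑ u : Fin m → Spin, rowWeight t w α u v e • spinProd c u

section Grassmann

variable {R : Type*} [CommRing R] {A : Type*} [Ring A] [Algebra R A] (t w : R) (α : ℕ → R)
  (c : ℕ → A)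

theorem rowSum_zero (e : Spin) (v : Fin 0 → Spin) :
    rowSum t w α c e v = if e = Spin.down then 1 else 0 := by
  simp [rowSum, rowWeight_zero, spinProd_zero]

theorem rowSum_snoc (e b : Spin) {m : ℕ} (v : Fin m → Spin) :
    rowSum t w α c e (Fin.snoc v b : Fin (m + 1) → Spin) =
      ∑ a, ∑ e', siteWeight t w α m a b e' e •
        (rowSum t w α c e' v * if a = Spin.down then c m else 1) := by
  rw [rowSum, Fin.sum_univ_pi_snoc]
  refine Finset.sum_congr rfl fun a _ => ?_
  simp only [rowSum, rowWeight_snoc, spinProd_snoc, Finset.sum_mul, Finset.smul_sum,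
    Finset.sum_smul]
  rw [Finset.sum_comm]
  refine Finset.sum_congr rfl fun e' _ => Finset.sum_congr rfl fun u _ => ?_
  rw [smul_mul_assoc, smul_smul, mul_comm]

theorem rowSum_snoc_up_up {m : ℕ} (v : Fin m → Spin) :
    rowSum t w α c Spin.up (Fin.snoc v Spin.up : Fin (m + 1) → Spin) =
      rowSum t w α c Spin.up v := by
  simp only [rowSum_snoc, Spin.sum_univ]
  simp [siteWeight, vertexType, boltzmannWeight]

theorem rowSum_snoc_up_down {m : ℕ} (v : Fin m → Spin) :
    rowSum t w α c Spin.up (Fin.snoc v Spin.down : Fin (m + 1) → Spin) =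
      rowSum t w α c Spin.down v + t • (rowSum t w α c Spin.up v * c m) := by
  simp only [rowSum_snoc, Spin.sum_univ]
  simp [siteWeight, vertexType, boltzmannWeight]

theorem rowSum_snoc_down_up {m : ℕ} (v : Fin m → Spin) :
    rowSum t w α c Spin.down (Fin.snoc v Spin.up : Fin (m + 1) → Spin) =
      (w + α (m + 1)) • rowSum t w α c Spin.down v +
        ((1 + t) * w) • (rowSum t w α c Spin.up v * c m) := by
  simp only [rowSum_snoc, Spin.sum_univ]
  simp [siteWeight, vertexType, boltzmannWeight]

theorem rowSum_snoc_down_down {m : ℕ} (v : Fin m → Spin) :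
    rowSum t w α c Spin.down (Fin.snoc v Spin.down : Fin (m + 1) → Spin) =
      (w - t * α (m + 1)) • (rowSum t w α c Spin.down v * c m) := by
  simp only [rowSum_snoc, Spin.sum_univ]
  simp [siteWeight, vertexType, boltzmannWeight]

/-- The sequence `(w | α)^l = ∏_{j < l} (w + α_{j+1})` of factorial powers. -/
def facPow (w : R) (α : ℕ → R) (l : ℕ) : R := ∏ j ∈ Finset.range l, (w + α (j + 1))

theorem facPow_zero (w : R) (α : ℕ → R) : facPow w α 0 = 1 := by simp [facPow]

theorem facPow_succ (w : R) (α : ℕ → R) (l : ℕ) :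
    facPow w α (l + 1) = (w + α (l + 1)) * facPow w α l := by
  rw [facPow, Finset.prod_range_succ, mul_comm]; rfl

variable {t w α c} {y x : ℕ → A}

theorem rowSum_down_eq (hcc : ∀ m, c m * c m = 0) (hyy : ∀ m, y m * y m = 0)
    (hyc : ∀ m, y m * c m = -(c m * y m))
    (hy : ∀ m, y (m + 1) = c m + (w + α (m + 1)) • y m)
    (hx : ∀ m, x m = t • c m + ((1 + t) * w) • y m) {m : ℕ} (v : Fin m → Spin) :
    rowSum t w α c Spin.down v = facPow w α m • spinProd (fun j => -x j) v +
      ((1 + t) * w) • (rowSum t w α c Spin.up v * y m) := by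
  induction m with
  | zero => simp [rowSum_zero, spinProd_zero, facPow_zero]
  | succ m ih =>
    rw [← Fin.snoc_init_self v]
    have ih := ih (Fin.init v)
    cases v (Fin.last m)
    · rw [rowSum_snoc_down_up, rowSum_snoc_up_up, spinProd_snoc, facPow_succ, hy, ih]
      simp only [mul_add, smul_add, mul_smul_comm, smul_smul]
      simp
      ring_nf
      abel
    · rw [rowSum_snoc_down_down, rowSum_snoc_up_down, spinProd_snoc, facPow_succ, hy, ih]
      simp only [if_true]
      rw [hx]
      have h1 : ∀ X : A, X * c m * c m = 0 := fun X => by rw [mul_assoc, hcc, mul_zero]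
      have h2 : ∀ X : A, X * y m * y m = 0 := fun X => by rw [mul_assoc, hyy, mul_zero]
      have h3 : ∀ X : A, X * y m * c m = -(X * c m * y m) := fun X => by
        rw [mul_assoc, hyc, mul_neg, mul_assoc]
      simp only [add_mul, mul_add, smul_add, mul_smul_comm, smul_mul_assoc, smul_smul, h1, h2, h3,
        mul_neg, neg_add, smul_neg, smul_zero, ← mul_assoc]
      module

theorem spinProd_mul_of_anticomm {x : ℕ → A} {e : A} (hex : ∀ m, x m * e = -(e * x m)) {m : ℕ}
    (v : Fin m → Spin) : spinProd x v * e = e * spinProd (fun j => -x j) v := by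
  induction m with
  | zero => simp [spinProd_zero]
  | succ m ih =>
    rw [← Fin.snoc_init_self v, spinProd_snoc, spinProd_snoc, ← mul_assoc, ← ih]
    split_ifs
    · rw [mul_assoc, hex, mul_neg, mul_neg, mul_assoc]
    · simp

/-- The row transfer matrix sends a wedge product of columns to the component along the new
direction `e` of a wedge product of columns. -/
theorem spinProd_add_smul (hcc : ∀ m, c m * c m = 0) (hyy : ∀ m, y m * y m = 0)
    (hyc : ∀ m, y m * c m = -(c m * y m))
    (hy : ∀ m, y (m + 1) = c m + (w + α (m + 1)) • y m)
    (hx : ∀ m, x m = t • c m + ((1 + t) * w) • y m) {e : A} (hee : e * e = 0)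
    (hec : ∀ m, c m * e = -(e * c m)) (hex : ∀ m, x m * e = -(e * x m)) {m : ℕ}
    (v : Fin m → Spin) :
    spinProd (fun j => facPow w α j • e + x j) v =
      spinProd x v + e * rowSum t w α c Spin.up v := by
  have hes : ∀ {m : ℕ} (v : Fin m → Spin), e * rowSum t w α c Spin.up v * e = 0 := by
    intro m v
    simp only [rowSum, Finset.mul_sum, Finset.sum_mul, mul_smul_comm, smul_mul_assoc, mul_assoc,
      spinProd_mul_of_anticomm hec]
    simp [← mul_assoc, hee]
  induction m with
  | zero => simp [spinProd_zero, rowSum_zero]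
  | succ m ih =>
    rw [← Fin.snoc_init_self v]
    have ih := ih (Fin.init v)
    cases v (Fin.last m)
    · rw [rowSum_snoc_up_up, spinProd_snoc, spinProd_snoc]
      simp [ih]
    · rw [rowSum_snoc_up_down, spinProd_snoc, spinProd_snoc,
        rowSum_down_eq hcc hyy hyc hy hx, ih]
      simp only [if_true, add_mul, mul_add, mul_smul_comm, hes, spinProd_mul_of_anticomm hex, hx,
        ← mul_assoc]
      module

end Grassmann

theorem List.exists_eq_ofFn_of_length_eq {β : Type*} {L : List β} {k : ℕ} (h : L.length = k) :
    ∃ l : Fin k → β, L = List.ofFn l := by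
  subst h
  exact ⟨L.get, (List.ofFn_get L).symm⟩

open ExteriorAlgebra in
/-- The linear form on the exterior algebra of `R^k` that is the determinant in degree `k` and
vanishes in all other degrees. -/
noncomputable def detForm (R : Type*) [CommRing R] (k : ℕ) :
    ExteriorAlgebra R (Fin k → R) →ₗ[R] R :=
  liftAlternating (Pi.single k Matrix.detRowAlternating)

section DetForm

variable {R : Type*} [CommRing R]

theorem detForm_ofFn {k : ℕ} (x : Fin k → Fin k → R) :
    detForm R k (List.ofFn fun i => ExteriorAlgebra.ι R (x i)).prod = Matrix.det (Matrix.of x) := by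
  rw [← ExteriorAlgebra.ιMulti_apply, detForm, ExteriorAlgebra.liftAlternating_apply_ιMulti,
    Pi.single_eq_same]
  rfl

theorem detForm_ofFn_of_ne {k l : ℕ} (h : l ≠ k) (x : Fin l → Fin k → R) :
    detForm R k (List.ofFn fun i => ExteriorAlgebra.ι R (x i)).prod = 0 := by
  rw [← ExteriorAlgebra.ιMulti_apply, detForm, ExteriorAlgebra.liftAlternating_apply_ιMulti,
    Pi.single_eq_of_ne h]
  rfl

theorem detForm_map_of_length_ne {k : ℕ} {L : List (Fin k → R)} (h : L.length ≠ k) :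
    detForm R k (L.map (ExteriorAlgebra.ι R)).prod = 0 := by
  rw [← List.ofFn_get L, List.map_ofFn]
  exact detForm_ofFn_of_ne h _

/-- A wedge product of vectors whose first coordinate vanishes has determinant zero. -/
theorem detForm_map_cons_zero {k : ℕ} (L : List (Fin k → R)) :
    detForm R (k + 1) (L.map fun x => ExteriorAlgebra.ι R (Fin.cons 0 x : Fin (k + 1) → R)).prod =
      0 := by
  by_cases h : L.length = k + 1
  · obtain ⟨l, rfl⟩ : ∃ l : Fin (k + 1) → Fin k → R, L = List.ofFn l :=
      List.exists_eq_ofFn_of_length_eq h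
    rw [List.map_ofFn]
    refine (detForm_ofFn fun i => (Fin.cons 0 (l i) : Fin (k + 1) → R)).trans ?_
    exact Matrix.det_eq_zero_of_column_eq_zero 0 fun i => by simp
  · have := detForm_map_of_length_ne (L := L.map fun x => (Fin.cons 0 x : Fin (k + 1) → R))
      (by simpa using h)
    rwa [List.map_map] at this

theorem detForm_mul_map_cons_zero {k : ℕ} (L : List (Fin k → R)) :
    detForm R (k + 1) (ExteriorAlgebra.ι R (Fin.cons 1 0 : Fin (k + 1) → R) *
      (L.map fun x => ExteriorAlgebra.ι R (Fin.cons 0 x : Fin (k + 1) → R)).prod) =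
      detForm R k (L.map (ExteriorAlgebra.ι R)).prod := by
  by_cases h : L.length = k
  · obtain ⟨l, rfl⟩ : ∃ l : Fin k → Fin k → R, L = List.ofFn l :=
      List.exists_eq_ofFn_of_length_eq h
    rw [List.map_ofFn, List.map_ofFn]
    have h1 := detForm_ofFn (R := R) (k := k + 1)
      (Fin.cons (Fin.cons 1 0 : Fin (k + 1) → R) fun i => Fin.cons 0 (l i))
    rw [List.ofFn_succ, List.prod_cons] at h1
    simp only [Fin.cons_zero, Fin.cons_succ] at h1
    refine h1.trans ((Eq.symm ?_).trans (detForm_ofFn l).symm)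
    rw [Matrix.det_succ_row_zero, Fin.sum_univ_succ]
    simp
    rfl
  · rw [detForm_map_of_length_ne h]
    have := detForm_map_of_length_ne
      (L := (Fin.cons 1 0 : Fin (k + 1) → R) :: L.map fun x => (Fin.cons 0 x : Fin (k + 1) → R))
      (by simpa using h)
    rwa [List.map_cons, List.map_map, List.prod_cons] at this

end DetForm

/-- The positions of the down spins, in increasing order. -/
def downs {m : ℕ} (v : Fin m → Spin) : List ℕ :=
  List.map (fun j : Fin m => (j : ℕ))
    (List.filter (fun j : Fin m => v j = Spin.down) (List.finRange m))

theorem spinProd_eq_map_downs {A : Type*} [Monoid A] (c : ℕ → A) {m : ℕ} (v : Fin m → Spin) :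
    spinProd c v = ((downs v).map c).prod := by
  rw [spinProd, List.ofFn_eq_map, downs]
  induction List.finRange m with
  | nil => rfl
  | cons a L ih =>
    by_cases h : v a = Spin.down <;> simp [h, ih]

section SpinDet

variable {R : Type*} [CommRing R]

/-- The minor of the rows `g` in the columns with a down spin (zero if the number of these columns
is not the number of rows). -/
noncomputable def spinDet {k : ℕ} (g : Fin k → ℕ → R) {m : ℕ} (v : Fin m → Spin) : R :=
  detForm R k (spinProd (fun j => ExteriorAlgebra.ι R fun i => g i j) v)

theorem spinDet_of_downs_eq {k : ℕ} (g : Fin k → ℕ → R) {m : ℕ} {v : Fin m → Spin}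
    {l : Fin k → ℕ} (h : downs v = List.ofFn l) :
    spinDet g v = Matrix.det (Matrix.of fun i j => g i (l j)) := by
  rw [spinDet, spinProd_eq_map_downs, h, List.map_ofFn, ← Matrix.det_transpose]
  exact detForm_ofFn fun j i => g i (l j)

theorem spinDet_of_length_ne {k : ℕ} (g : Fin k → ℕ → R) {m : ℕ} {v : Fin m → Spin}
    (h : (downs v).length ≠ k) : spinDet g v = 0 := by
  rw [spinDet, spinProd_eq_map_downs]
  have := detForm_map_of_length_ne (L := (downs v).map fun j => fun i => g i j) (by simpa using h)
  rwa [List.map_map] at this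

/-- Multiplying the matrix of rows by a square matrix multiplies the minors by its determinant. -/
theorem spinDet_mul {k : ℕ} (L : Matrix (Fin k) (Fin k) R) (g : Fin k → ℕ → R) {m : ℕ}
    (v : Fin m → Spin) :
    spinDet (fun i j => ∑ i', L i i' * g i' j) v = L.det * spinDet g v := by
  by_cases h : (downs v).length = k
  · obtain ⟨l, hl⟩ : ∃ l : Fin k → ℕ, downs v = List.ofFn l :=
      List.exists_eq_ofFn_of_length_eq h
    rw [spinDet_of_downs_eq _ hl, spinDet_of_downs_eq _ hl, ← Matrix.det_mul]
    rfl
  · rw [spinDet_of_length_ne _ h, spinDet_of_length_ne _ h, mul_zero]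

/-- The resolvent: `res w α g l = ∑_{k < l} g k ∏_{k < j < l} (w + α_{j+1})`. -/
def res (w : R) (α : ℕ → R) (g : ℕ → R) : ℕ → R
  | 0 => 0
  | l + 1 => g l + (w + α (l + 1)) * res w α g l

theorem ι_mul_ι_anticomm {M : Type*} [AddCommGroup M] [Module R M] (x y : M) :
    ExteriorAlgebra.ι R x * ExteriorAlgebra.ι R y =
      -(ExteriorAlgebra.ι R y * ExteriorAlgebra.ι R x) := by
  rw [eq_neg_iff_add_eq_zero, ExteriorAlgebra.ι_add_mul_swap]

/-- Cauchy–Binet for the row transfer matrix. -/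
theorem sum_rowWeight_mul_spinDet (t w : R) (α : ℕ → R) {k : ℕ} (g : Fin k → ℕ → R) {m : ℕ}
    (v : Fin m → Spin) :
    ∑ u : Fin m → Spin, rowWeight t w α u v Spin.up * spinDet g u =
      spinDet (Fin.cons (facPow w α) fun i j => t * g i j + (1 + t) * w * res w α (g i) j :
        Fin (k + 1) → ℕ → R) v := by
  let E : (Fin k → R) → ExteriorAlgebra R (Fin (k + 1) → R) := fun x =>
    ExteriorAlgebra.ι R (Fin.cons 0 x : Fin (k + 1) → R)
  let e := ExteriorAlgebra.ι R (Fin.cons 1 0 : Fin (k + 1) → R)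
  let X : ℕ → Fin k → R := fun j i => t * g i j + (1 + t) * w * res w α (g i) j
  have key := spinProd_add_smul (t := t) (w := w) (α := α) (c := fun j => E fun i => g i j)
    (y := fun j => E fun i => res w α (g i) j) (x := fun j => E (X j)) (e := e)
    (fun _ => ExteriorAlgebra.ι_sq_zero _) (fun _ => ExteriorAlgebra.ι_sq_zero _)
    (fun _ => ι_mul_ι_anticomm _ _)
    (fun j => by
      simp only [E, ← map_smul, ← map_add]
      congr 1
      ext i
      refine Fin.cases ?_ (fun i => ?_) i <;> simp [res])
    (fun j => by
      simp only [E, X, ← map_smul, ← map_add]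
      congr 1
      ext i
      refine Fin.cases ?_ (fun i => ?_) i <;> simp)
    (ExteriorAlgebra.ι_sq_zero _) (fun _ => ι_mul_ι_anticomm _ _) (fun _ => ι_mul_ι_anticomm _ _) v
  have hl : ∀ j, facPow w α j • e + E (X j) = ExteriorAlgebra.ι R fun i =>
      (Fin.cons (facPow w α) fun i j => t * g i j + (1 + t) * w * res w α (g i) j :
        Fin (k + 1) → ℕ → R) i j := by
    intro j
    simp only [E, e, X, ← map_smul, ← map_add]
    congr 1
    ext i
    refine Fin.cases ?_ (fun i => ?_) i <;> simp
  simp only [hl] at key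
  rw [spinDet, key, map_add, spinProd_eq_map_downs]
  have h0 := detForm_map_cons_zero ((downs v).map X)
  rw [List.map_map] at h0
  rw [show detForm R (k + 1) ((downs v).map fun j => E (X j)).prod = 0 from h0, zero_add, rowSum,
    Finset.mul_sum, map_sum]
  refine Finset.sum_congr rfl fun u _ => ?_
  rw [mul_smul_comm, map_smul, smul_eq_mul, spinDet, spinProd_eq_map_downs, spinProd_eq_map_downs]
  have h1 := detForm_mul_map_cons_zero ((downs u).map fun j => fun i => g i j)
  rw [List.map_map, List.map_map] at h1
  exact congrArg _ h1.symm

end SpinDet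

section JacobiTrudi

variable {R : Type*} [CommRing R]

theorem res_add_smul (w : R) (α : ℕ → R) (g g' : ℕ → R) (a : R) (l : ℕ) :
    res w α (fun j => g j + a * g' j) l = res w α g l + a * res w α g' l := by
  induction l with
  | zero => simp [res]
  | succ l ih => simp only [res, ih]; ring

theorem res_eq_add_res_res (y w : R) (α : ℕ → R) (g : ℕ → R) (l : ℕ) :
    res y α g l = res w α g l + (y - w) * res w α (res y α g) l := by
  induction l with
  | zero => simp [res]
  | succ l ih =>
    have h : res y α g (l + 1) = g l + (y - w) * res y α g l + (w + α (l + 1)) * res y α g l := by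
      simp only [res]; ring
    rw [h]
    simp only [res]
    linear_combination (w + α (l + 1)) * ih

theorem facPow_eq_add_res (y w : R) (α : ℕ → R) (l : ℕ) :
    facPow y α l = facPow w α l + (y - w) * res w α (facPow y α) l := by
  induction l with
  | zero => simp [res, facPow_zero]
  | succ l ih =>
    simp only [facPow_succ, res]
    linear_combination (w + α (l + 1)) * ih

/-- The rows of the flagged Jacobi–Trudi matrix of the factorial Schur functions in the variables
`z`: row `n - 1 - i` is the divided difference of the factorial powers at `z_i, …, z_{n-1}`. -/
def jtRow (α : ℕ → R) : (n : ℕ) → (Fin n → R) → Fin n → ℕ → R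
  | 0, _ => finZeroElim
  | n + 1, z => Fin.cons (facPow (z (Fin.last n)) α) fun i =>
      res (z (Fin.last n)) α (jtRow α n (Fin.init z) i)

theorem jtRow_zero_row (α : ℕ → R) {n : ℕ} (z : Fin (n + 1) → R) :
    jtRow α (n + 1) z 0 = facPow (z (Fin.last n)) α := rfl

theorem jtRow_succ_row (α : ℕ → R) {n : ℕ} (z : Fin (n + 1) → R) (i : Fin n) :
    jtRow α (n + 1) z i.succ = res (z (Fin.last n)) α (jtRow α n (Fin.init z) i) := rfl

theorem jtRow_init (α : ℕ → R) {n : ℕ} (z : Fin (n + 1) → R) (i : Fin n) (l : ℕ) :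
    jtRow α n (Fin.init z) i l = jtRow α (n + 1) z i.castSucc l +
      (Fin.init z i.rev - z (Fin.last n)) * jtRow α (n + 1) z i.succ l := by
  induction n generalizing l with
  | zero => exact i.elim0
  | succ n ih =>
    refine Fin.cases ?_ (fun i => ?_) i
    · rw [Fin.castSucc_zero, jtRow_succ_row, jtRow_zero_row, jtRow_zero_row, Fin.rev_zero]
      exact facPow_eq_add_res _ _ _ _
    · rw [← Fin.succ_castSucc, jtRow_succ_row, jtRow_succ_row, jtRow_succ_row, jtRow_succ_row,
        Fin.rev_succ]
      have h1 := res_eq_add_res_res (Fin.init z (Fin.last n)) (z (Fin.last (n + 1))) α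
        (jtRow α n (Fin.init (Fin.init z)) i) l
      have h2 : res (z (Fin.last (n + 1))) α (jtRow α n (Fin.init (Fin.init z)) i) l = _ :=
        congrArg (fun g => res (z (Fin.last (n + 1))) α g l)
          (funext fun j => ih (Fin.init z) i j)
      rw [res_add_smul] at h2
      rw [h1, h2, jtRow_succ_row]
      simp only [Fin.init]
      ring

theorem spinDet_row_update (t : R) (α : ℕ → R) {n : ℕ} (z : Fin (n + 1) → R) {m : ℕ}
    (v : Fin m → Spin) :
    spinDet (Fin.cons (facPow (z (Fin.last n)) α) fun i j =>
      t * jtRow α n (Fin.init z) i j +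
        (1 + t) * z (Fin.last n) * res (z (Fin.last n)) α (jtRow α n (Fin.init z) i) j :
        Fin (n + 1) → ℕ → R) v =
      (∏ i : Fin n, (t * z i.castSucc + z (Fin.last n))) * spinDet (jtRow α (n + 1) z) v := by
  let L : Matrix (Fin (n + 1)) (Fin (n + 1)) R := Matrix.of (Fin.cons (Pi.single 0 1) fun i =>
    t • Pi.single i.castSucc 1 + (t * z i.rev.castSucc + z (Fin.last n)) • Pi.single i.succ 1)
  have hL : L.det = ∏ i : Fin n, (t * z i.castSucc + z (Fin.last n)) := by
    rw [Matrix.det_of_isLowerTriangular, Fin.prod_univ_succ,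
      ← Equiv.prod_comp Fin.revPerm fun i : Fin n => t * z i.castSucc + z (Fin.last n)]
    · simp [L, Fin.castSucc_lt_succ.ne']
    · intro i j hij
      have hij : i < j := hij
      revert hij
      refine Fin.cases ?_ (fun i => ?_) i
      · intro h
        simp [L, h.ne']
      · intro h
        have h1 : j ≠ i.castSucc := (lt_trans Fin.castSucc_lt_succ h).ne'
        simp [L, h.ne', h1]
  rw [← hL, ← spinDet_mul]
  congr 1
  ext i j
  refine Fin.cases ?_ (fun i => ?_) i
  · simp [L, Pi.single_apply, jtRow_zero_row]
  · simp only [L, Fin.cons_succ, Matrix.of_apply, Pi.add_apply, Pi.smul_apply, Pi.single_apply,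
      smul_eq_mul, mul_ite, mul_one, mul_zero, add_mul, ite_mul, zero_mul, Finset.sum_add_distrib,
      Finset.sum_ite_eq', Finset.mem_univ, if_true]
    rw [jtRow_init, jtRow_succ_row]
    simp only [Fin.init]
    ring

end JacobiTrudi

section Lattice

variable {R : Type*} [CommRing R]

/-- The sum over the states of the lattice with top spins up and bottom spins `v`, built up row by
row. -/
def latticeSum (t : R) (α : ℕ → R) {m : ℕ} : (n : ℕ) → (Fin n → R) → (Fin m → Spin) → R
  | 0, _, v => if v = fun _ => Spin.up then 1 else 0
  | n + 1, z, v => ∑ u : Fin m → Spin,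
      rowWeight t (z (Fin.last n)) α u v Spin.up * latticeSum t α n (Fin.init z) u

theorem prod_Ioi_castSucc {n : ℕ} (f : Fin (n + 1) → Fin (n + 1) → R) :
    ∏ i, ∏ j ∈ Finset.Ioi i, f i j =
      (∏ i : Fin n, f i.castSucc (Fin.last n)) *
        ∏ i : Fin n, ∏ j ∈ Finset.Ioi i, f i.castSucc j.castSucc := by
  have h : ∀ (k : ℕ) (F : Fin k → Fin k → R) (i : Fin k),
      ∏ j ∈ Finset.Ioi i, F i j = ∏ j, if i < j then F i j else 1 := by
    intro k F i
    rw [← Finset.prod_filter]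
    congr 1
    ext; simp
  simp only [h _ f, h _ fun i j : Fin n => f i.castSucc j.castSucc]
  rw [Fin.prod_univ_castSucc, ← Finset.prod_mul_distrib]
  have h2 : ∏ j, (if Fin.last n < j then f (Fin.last n) j else 1) = 1 :=
    Finset.prod_eq_one fun j _ => if_neg (Fin.le_last j).not_gt
  rw [h2, mul_one]
  refine Finset.prod_congr rfl fun i _ => ?_
  rw [Fin.prod_univ_castSucc, mul_comm, if_pos (Fin.castSucc_lt_last i)]
  simp

theorem downs_eq_nil_iff {m : ℕ} {v : Fin m → Spin} : downs v = [] ↔ v = fun _ => Spin.up := by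
  rw [downs, List.map_eq_nil_iff, List.filter_eq_nil_iff, funext_iff]
  refine ⟨fun h j => ?_, fun h j _ => by simp [h j]⟩
  have := h j (List.mem_finRange j)
  cases hv : v j
  · rfl
  · simp [hv] at this

theorem latticeSum_eq (t : R) (α : ℕ → R) {m n : ℕ} (z : Fin n → R) (v : Fin m → Spin) :
    latticeSum t α n z v =
      (∏ i : Fin n, ∏ j ∈ Finset.Ioi i, (t * z i + z j)) * spinDet (jtRow α n z) v := by
  induction n generalizing v with
  | zero =>
    rw [latticeSum]
    split_ifs with h
    · have hd : downs v = List.ofFn finZeroElim := by simp [downs_eq_nil_iff.2 h]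
      simp [spinDet_of_downs_eq _ hd]
    · rw [← downs_eq_nil_iff, ← List.length_eq_zero_iff] at h
      rw [spinDet_of_length_ne _ h, mul_zero]
  | succ n ih =>
    rw [latticeSum, prod_Ioi_castSucc, mul_right_comm, ← spinDet_row_update,
      ← sum_rowWeight_mul_spinDet, Finset.sum_mul]
    refine Finset.sum_congr rfl fun u _ => ?_
    rw [ih]
    simp only [Fin.init]
    ring

theorem sum_vert_eq_latticeSum (t : R) (α : ℕ → R) {m n : ℕ} (z : Fin n → R) (v : Fin m → Spin) :
    (∑ V : Fin (n + 1) → Fin m → Spin,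
      if (V 0 = fun _ => Spin.up) ∧ V (Fin.last n) = v then
        ∏ i : Fin n, rowWeight t (z i) α (V i.castSucc) (V i.succ) Spin.up else 0) =
      latticeSum t α n z v := by
  induction n generalizing v with
  | zero =>
    rw [Fin.sum_univ_pi_snoc, latticeSum, Fintype.sum_eq_single v]
    · simp [Fin.snoc]
    · intro x hx
      simp [Fin.snoc, hx]
  | succ n ih =>
    rw [Fin.sum_univ_pi_snoc, latticeSum, Fintype.sum_eq_single v]
    · simp only [← ih, Finset.mul_sum]
      rw [Finset.sum_comm]
      refine Finset.sum_congr rfl fun V _ => ?_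
      rw [Fintype.sum_eq_single (V (Fin.last n))]
      · have h0 : (Fin.snoc V v : Fin (n + 2) → Fin m → Spin) 0 = V 0 := by
          rw [← Fin.castSucc_zero, Fin.snoc_castSucc]
        simp only [h0, Fin.snoc_last, and_true, Fin.prod_univ_castSucc, Fin.snoc_castSucc,
          Fin.succ_last, Fin.succ_castSucc, Fin.init]
        split_ifs
        · rw [mul_comm]
        · simp
      · intro x hx
        simp [hx.symm]
    · intro x hx
      simp [hx]

theorem sum_horiz_eq_prod_rowWeight (t : R) (α : ℕ → R) {m n : ℕ} (z : Fin n → R)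
    (V : Fin (n + 1) → Fin m → Spin) :
    (∑ H : Fin n → Fin (m + 1) → Spin,
      if ∀ i, H i 0 = Spin.down ∧ H i (Fin.last m) = Spin.up then
        ∏ i : Fin n, ∏ j : Fin m, siteWeight t (z i) α j (V i.castSucc j) (V i.succ j)
          (H i j.castSucc) (H i j.succ) else 0) =
      ∏ i : Fin n, rowWeight t (z i) α (V i.castSucc) (V i.succ) Spin.up := by
  simp only [rowWeight, Finset.prod_univ_sum, Fintype.piFinset_univ, Finset.prod_ite_zero,
    Finset.mem_univ, true_imp_iff]

/-- The spins on the bottom boundary. -/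
def bottomSpin (μ : YoungDiagram) (n m : ℕ) (j : Fin m) : Spin :=
  if IsShiftedPart μ n ((j : ℕ) + 1) then Spin.down else Spin.up

theorem partitionFunction_eq_latticeSum (μ : YoungDiagram) (n : ℕ) (t : R) (z : Fin n → R)
    (α : ℕ → R) :
    partitionFunction μ n t z α = latticeSum t α n z (bottomSpin μ n (μ.rowLen 0 + n)) := by
  have h1 : partitionFunction μ n t z α = ∑ s : SpinConfig n (μ.rowLen 0 + n),
      if HasBoundary μ s then ∏ i : Fin n, ∏ j, s.weightAt t z α i j else 0 := by
    rw [partitionFunction, sixVertexStates, Finset.sum_filter]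
    refine Finset.sum_congr rfl fun s _ => ?_
    by_cases hb : HasBoundary μ s
    · by_cases hs : IsSixVertex s
      · simp [hb, hs]
      · rw [if_neg (fun h => hs h.2), if_pos hb]
        simp only [IsSixVertex, not_forall] at hs
        obtain ⟨i, j, hij⟩ := hs
        refine (Finset.prod_eq_zero (Finset.mem_univ i)
          (Finset.prod_eq_zero (Finset.mem_univ j) ?_)).symm
        rw [Bool.not_eq_true, Option.isSome_eq_false_iff, Option.isNone_iff_eq_none] at hij
        simp [SpinConfig.weightAt, hij]
    · simp [hb]
  rw [h1, ← sum_vert_eq_latticeSum, ← (SpinConfig.equivProd n _).sum_comp, Fintype.sum_prod_type]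
  refine Finset.sum_congr rfl fun V _ => ?_
  simp only [← sum_horiz_eq_prod_rowWeight]
  have hP : ∀ (P : Prop) [Decidable P] (f : (Fin n → Fin (μ.rowLen 0 + n + 1) → Spin) → R),
      (if P then ∑ H, f H else 0) = ∑ H, if P then f H else 0 := by
    intro P _ f
    split_ifs <;> simp
  rw [hP]
  refine Finset.sum_congr rfl fun H _ => ?_
  rw [← ite_and]
  refine if_congr ?_ rfl rfl
  simp only [HasBoundary, SpinConfig.equivProd, Equiv.coe_fn_mk, funext_iff, bottomSpin,
    forall_and]
  tauto

end Lattice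

section Columns

/-- The parts of `μ + (n, n - 1, …, 1)` less one, in increasing order. -/
def shiftedPart (μ : YoungDiagram) (n : ℕ) (j : Fin n) : ℕ := μ.rowLen j.rev + j

theorem shiftedPart_strictMono (μ : YoungDiagram) (n : ℕ) : StrictMono (shiftedPart μ n) := by
  intro i j h
  have h1 : μ.rowLen i.rev ≤ μ.rowLen j.rev :=
    μ.rowLen_anti _ _ (Fin.val_le_of_le (Fin.rev_le_rev.2 h.le))
  have h2 : (i : ℕ) < j := h
  simp only [shiftedPart]
  omega

theorem isShiftedPart_succ_iff (μ : YoungDiagram) (n j : ℕ) :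
    IsShiftedPart μ n (j + 1) ↔ ∃ i, shiftedPart μ n i = j := by
  rw [IsShiftedPart, ← Fin.revPerm.exists_congr_right]
  refine exists_congr fun i => ?_
  simp only [shiftedPart, Fin.revPerm_apply, Fin.val_rev]
  omega

theorem downs_bottomSpin (μ : YoungDiagram) {n m : ℕ} (hm : μ.rowLen 0 + n ≤ m) :
    downs (bottomSpin μ n m) = List.ofFn (shiftedPart μ n) := by
  have h1 : (downs (bottomSpin μ n m)).Pairwise (· < ·) := by
    rw [downs, List.pairwise_map]
    exact (List.pairwise_lt_finRange m).filter _
  have h2 : (List.ofFn (shiftedPart μ n)).Pairwise (· < ·) := by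
    rw [List.pairwise_ofFn]
    exact fun i j h => shiftedPart_strictMono μ n h
  refine List.Perm.eq_of_pairwise (le := (· < ·)) (fun a b _ _ h h' => absurd h h'.asymm) h1 h2 ?_
  rw [List.perm_ext_iff_of_nodup (h1.imp ne_of_lt) (h2.imp ne_of_lt)]
  intro a
  simp only [downs, List.mem_map, List.mem_filter, List.mem_finRange, true_and, bottomSpin,
    List.mem_ofFn', Set.mem_range, isShiftedPart_succ_iff]
  constructor
  · rintro ⟨j, hj, rfl⟩
    by_contra h
    simp [h] at hj
  · rintro ⟨i, rfl⟩
    have : shiftedPart μ n i < m := by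
      have := μ.rowLen_anti 0 i.rev (Nat.zero_le _)
      have := i.isLt
      simp only [shiftedPart]
      omega
    exact ⟨⟨_, this⟩, by simp⟩

variable {R : Type*} [CommRing R]

theorem facPow_eq_prod_Ico_mul (w : R) (α : ℕ → R) {p q : ℕ} (h : p ≤ q) :
    facPow w α q = (∏ j ∈ Finset.Ico p q, (w + α (j + 1))) * facPow w α p := by
  rw [facPow, facPow, mul_comm, Finset.prod_range_mul_prod_Ico _ h]

theorem res_eq_prod_Ico_mul_add_sum (w : R) (α : ℕ → R) (g : ℕ → R) {p q : ℕ} (h : p ≤ q) :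
    res w α g q = (∏ j ∈ Finset.Ico p q, (w + α (j + 1))) * res w α g p +
      ∑ k ∈ Finset.Ico p q, (∏ j ∈ Finset.Ico (k + 1) q, (w + α (j + 1))) * g k := by
  induction q, h using Nat.le_induction with
  | base => simp
  | succ q h ih =>
    rw [res, ih, Finset.prod_Ico_succ_top h, Finset.sum_Ico_succ_top h]
    have : ∀ k ∈ Finset.Ico p q, (∏ j ∈ Finset.Ico (k + 1) (q + 1), (w + α (j + 1))) * g k =
        (w + α (q + 1)) * ((∏ j ∈ Finset.Ico (k + 1) q, (w + α (j + 1))) * g k) := by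
      intro k hk
      rw [Finset.prod_Ico_succ_top (Finset.mem_Ico.1 hk).2]
      ring
    rw [Finset.sum_congr rfl this, ← Finset.mul_sum]
    simp
    ring

/-- Branching of the minors of the rows `facPow w α, res w α g₀, …, res w α gₙ₋₁`. -/
theorem det_cons_facPow_res (w : R) (α : ℕ → R) {n : ℕ} (g : Fin n → ℕ → R)
    {l : Fin (n + 1) → ℕ} (hl : Monotone l) :
    Matrix.det (Matrix.of fun i j =>
      (Fin.cons (facPow w α) fun i => res w α (g i) : Fin (n + 1) → ℕ → R) i (l j)) =
      facPow w α (l 0) *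
        ∑ k ∈ Fintype.piFinset fun j : Fin n => Finset.Ico (l j.castSucc) (l j.succ),
          (∏ j, ∏ p ∈ Finset.Ico (k j + 1) (l j.succ), (w + α (p + 1))) *
            Matrix.det (Matrix.of fun i j => g i (k j)) := by
  let A : Fin (n + 1) → ℕ → R := Fin.cons (facPow w α) fun i => res w α (g i)
  let c : Fin n → R := fun j => ∏ p ∈ Finset.Ico (l j.castSucc) (l j.succ), (w + α (p + 1))
  let B : Matrix (Fin (n + 1)) (Fin (n + 1)) R := Matrix.of fun i =>
    Fin.cons (A i (l 0)) fun j => A i (l j.succ) - c j * A i (l j.castSucc)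
  have hle : ∀ j : Fin n, l j.castSucc ≤ l j.succ := fun j => hl Fin.castSucc_lt_succ.le
  have hAB : Matrix.det (Matrix.of fun i j => A i (l j)) = B.det := by
    refine Matrix.det_eq_of_forall_col_eq_smul_add_pred c (fun i => rfl) fun i j => ?_
    simp [B]
  have hB0 : ∀ j : Fin n, B 0 j.succ = 0 := by
    intro j
    simp only [B, A, c, Matrix.of_apply, Fin.cons_succ, Fin.cons_zero]
    rw [facPow_eq_prod_Ico_mul w α (hle j), sub_self]
  refine hAB.trans ?_
  rw [Matrix.det_succ_row_zero, Fin.sum_univ_succ, Finset.sum_eq_zero fun j _ => by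
    rw [hB0, mul_zero, zero_mul], add_zero]
  have hB : B.submatrix Fin.succ (Fin.succAbove 0) = Matrix.transpose (Matrix.of fun j i =>
      ∑ k ∈ Finset.Ico (l j.castSucc) (l j.succ),
        (∏ p ∈ Finset.Ico (k + 1) (l j.succ), (w + α (p + 1))) * g i k) := by
    ext i j
    simp only [Matrix.submatrix_apply, Fin.zero_succAbove, Matrix.transpose_apply, B, A, c,
      Matrix.of_apply, Fin.cons_succ]
    rw [res_eq_prod_Ico_mul_add_sum w α (g i) (hle j), add_sub_cancel_left]
  rw [hB, Matrix.det_transpose]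
  have h0 : (fun (j i : Fin n) => ∑ k ∈ Finset.Ico (l j.castSucc) (l j.succ),
        (∏ p ∈ Finset.Ico (k + 1) (l j.succ), (w + α (p + 1))) * g i k) =
      fun j : Fin n => ∑ k ∈ Finset.Ico (l j.castSucc) (l j.succ),
        (∏ p ∈ Finset.Ico (k + 1) (l j.succ), (w + α (p + 1))) • fun i => g i k := by
    ext j i
    simp
  have h1 := (Matrix.detRowAlternating (n := Fin n) (R := R)).toMultilinearMap.map_sum_finset
    (fun (j : Fin n) k => (∏ p ∈ Finset.Ico (k + 1) (l j.succ), (w + α (p + 1))) • fun i => g i k)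
    (fun j => Finset.Ico (l j.castSucc) (l j.succ))
  rw [← h0] at h1
  refine (congrArg _ h1).trans ?_
  simp only [B, A, Matrix.of_apply, Fin.cons_zero, Fin.val_zero, pow_zero, one_mul]
  congr 1
  refine Finset.sum_congr rfl fun k _ => ?_
  rw [MultilinearMap.map_smul_univ, smul_eq_mul]
  congr 1
  exact Matrix.det_transpose (Matrix.of fun i j => g i (k j))

/-- Branching of the Jacobi–Trudi determinants, in terms of row lengths. -/
theorem det_jtRow_succ (α : ℕ → R) {n : ℕ} (z : Fin (n + 1) → R) (μ : YoungDiagram) :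
    Matrix.det (Matrix.of fun i j => jtRow α (n + 1) z i (shiftedPart μ (n + 1) j)) =
      facPow (z (Fin.last n)) α (μ.rowLen n) *
        ∑ r ∈ Fintype.piFinset fun i : Fin n => Finset.Icc (μ.rowLen (i + 1)) (μ.rowLen i),
          (∏ i : Fin n, ∏ c ∈ Finset.Ico (r i) (μ.rowLen i),
            (z (Fin.last n) + α (n + c + 1 - i))) *
          Matrix.det (Matrix.of fun i j => jtRow α n (Fin.init z) i (r j.rev + j)) := by
  refine (det_cons_facPow_res (z (Fin.last n)) α (jtRow α n (Fin.init z))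
    (shiftedPart_strictMono μ (n + 1)).monotone).trans ?_
  congr 1
  have hs : ∀ j : Fin n, shiftedPart μ (n + 1) j.castSucc = μ.rowLen (j.rev + 1) + j ∧
      shiftedPart μ (n + 1) j.succ = μ.rowLen j.rev + j + 1 := by
    intro j
    simp only [shiftedPart, Fin.rev_castSucc, Fin.rev_succ, Fin.val_succ, Fin.val_castSucc]
    exact ⟨trivial, rfl⟩
  refine Finset.sum_nbij' (fun k i => k i.rev - i.rev) (fun r j => r j.rev + j) ?_ ?_ ?_ ?_ ?_
  · intro k hk
    simp only [Fintype.mem_piFinset, Finset.mem_Ico, Finset.mem_Icc, hs] at hk ⊢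
    intro i
    have := hk i.rev
    rw [Fin.rev_rev] at this
    omega
  · intro r hr
    simp only [Fintype.mem_piFinset, Finset.mem_Ico, Finset.mem_Icc, hs] at hr ⊢
    intro j
    have := hr j.rev
    omega
  · intro k hk
    simp only [Fintype.mem_piFinset, Finset.mem_Ico, hs] at hk
    ext j
    have := hk j
    simp only [Fin.rev_rev]
    omega
  · intro r hr
    ext i
    simp
  · intro k hk
    simp only [Fintype.mem_piFinset, Finset.mem_Ico, hs] at hk
    have hk' : ∀ j : Fin n, k j - j + j = k j := fun j => by have := hk j; omega
    simp only [Fin.rev_rev, hk']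
    congr 1
    rw [← Equiv.prod_comp Fin.revPerm]
    refine Finset.prod_congr rfl fun i _ => ?_
    have h1 := hk i.rev
    rw [Fin.revPerm_apply, (hs i.rev).2, Fin.rev_rev]
    rw [Fin.rev_rev] at h1
    have h2 : (i.rev : ℕ) + i + 1 = n := by rw [Fin.val_rev]; omega
    rw [show k i.rev + 1 = k i.rev - i.rev + (i.rev + 1) by omega, add_assoc,
      ← Finset.prod_Ico_add' _ _ _ ((i.rev : ℕ) + 1)]
    refine Finset.prod_congr rfl fun c _ => ?_
    congr 2
    omega

end Columns

section Tableaux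

/-- The restriction of a tableau to a smaller shape. -/
def SemistandardYoungTableau.restrict {μ ν : YoungDiagram} (h : ν ≤ μ)
    (T : SemistandardYoungTableau μ) : SemistandardYoungTableau ν where
  entry i j := if (i, j) ∈ ν then T i j else 0
  row_weak' {i j1 j2} hj hc := by
    rw [if_pos hc, if_pos (ν.up_left_mem le_rfl hj.le hc)]
    exact T.row_weak hj (h hc)
  col_strict' {i1 i2 j} hi hc := by
    rw [if_pos hc, if_pos (ν.up_left_mem hi.le le_rfl hc)]
    exact T.col_strict hi (h hc)
  zeros' hc := if_neg hc

/-- The extension of a tableau with entries less than `n` by entries `n` in a horizontal strip. -/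
def SemistandardYoungTableau.extend {μ ν : YoungDiagram} (n : ℕ) (hle : ν ≤ μ)
    (hstrip : ∀ i j, (i + 1, j) ∈ μ → (i, j) ∈ ν) (T : SemistandardYoungTableau ν)
    (hT : ∀ i j, (i, j) ∈ ν → T i j < n) : SemistandardYoungTableau μ where
  entry i j := if (i, j) ∈ ν then T i j else if (i, j) ∈ μ then n else 0
  row_weak' {i j1 j2} hj hc := by
    by_cases h2 : (i, j2) ∈ ν
    · rw [if_pos h2, if_pos (ν.up_left_mem le_rfl hj.le h2)]
      exact T.row_weak hj h2
    · rw [if_neg h2, if_pos hc]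
      by_cases h1 : (i, j1) ∈ ν
      · rw [if_pos h1]
        exact (hT _ _ h1).le
      · rw [if_neg h1]
        split_ifs <;> simp
  col_strict' {i1 i2 j} hi hc := by
    have h1 : (i1, j) ∈ ν := hstrip _ _ (μ.up_left_mem hi le_rfl hc)
    rw [if_pos h1]
    by_cases h2 : (i2, j) ∈ ν
    · rw [if_pos h2]
      exact T.col_strict hi h2
    · rw [if_neg h2, if_pos hc]
      exact hT _ _ h1
  zeros' {i j} hc := by
    rw [if_neg (fun h => hc (hle h)), if_neg hc]

/-- The diagram contained in `μ` with (at most) `n` rows, of lengths bounded by `r`. -/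
def YoungDiagram.truncate (μ : YoungDiagram) {n : ℕ} (r : Fin n → ℕ) : YoungDiagram where
  cells := μ.cells.filter fun x => x.1 < n ∧ ∀ i : Fin n, (i : ℕ) ≤ x.1 → x.2 < r i
  isLowerSet := by
    rintro ⟨i1, j1⟩ ⟨i2, j2⟩ hle h
    simp only [Finset.coe_filter, Set.mem_ofPred_eq, YoungDiagram.mem_cells] at h ⊢
    obtain ⟨hi, hj⟩ := Prod.mk_le_mk.1 hle
    exact ⟨μ.up_left_mem hi hj h.1, hi.trans_lt h.2.1,
      fun i hi' => hj.trans_lt (h.2.2 i (hi'.trans hi))⟩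

variable {μ : YoungDiagram} {n : ℕ} {r : Fin n → ℕ}

theorem YoungDiagram.truncate_le (μ : YoungDiagram) (r : Fin n → ℕ) : μ.truncate r ≤ μ :=
  fun _ h => (YoungDiagram.mem_cells _).1 (Finset.mem_filter.1 h).1

/-- `r` is the sequence of row lengths of a diagram obtained from `μ` by removing a horizontal
strip. -/
abbrev Interlaces (μ : YoungDiagram) {n : ℕ} (r : Fin n → ℕ) : Prop :=
  r ∈ Fintype.piFinset fun i : Fin n => Finset.Icc (μ.rowLen (i + 1)) (μ.rowLen i)

theorem Interlaces.bounds (h : Interlaces μ r) (i : Fin n) :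
    μ.rowLen (i + 1) ≤ r i ∧ r i ≤ μ.rowLen i := by
  simpa using Fintype.mem_piFinset.1 h i

theorem Interlaces.mem_truncate (h : Interlaces μ r) {i j : ℕ} :
    (i, j) ∈ μ.truncate r ↔ ∃ hi : i < n, j < r ⟨i, hi⟩ := by
  rw [← YoungDiagram.mem_cells]
  simp only [YoungDiagram.truncate, Finset.mem_filter, YoungDiagram.mem_cells]
  constructor
  · rintro ⟨-, hi, hr⟩
    exact ⟨hi, hr ⟨i, hi⟩ le_rfl⟩
  · rintro ⟨hi, hj⟩
    refine ⟨YoungDiagram.mem_iff_lt_rowLen.2 (hj.trans_le (h.bounds _).2), hi, fun i' hi' => ?_⟩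
    rcases eq_or_lt_of_le hi' with he | hlt
    · have : i' = ⟨i, hi⟩ := Fin.ext he
      rwa [this]
    · exact hj.trans_le ((h.bounds _).2.trans ((μ.rowLen_anti _ _ hlt).trans (h.bounds i').1))

theorem Interlaces.rowLen_truncate (h : Interlaces μ r) (i : Fin n) :
    (μ.truncate r).rowLen i = r i := by
  refine eq_of_forall_lt_iff fun j => ?_
  rw [← YoungDiagram.mem_iff_lt_rowLen, h.mem_truncate]
  exact ⟨fun ⟨_, hj⟩ => hj, fun hj => ⟨i.isLt, hj⟩⟩

theorem lt_of_mem_of_colLen_le (hμ : μ.colLen 0 ≤ n) {i j : ℕ} (h : (i, j) ∈ μ) : i < n :=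
  (YoungDiagram.mem_iff_lt_colLen.1 (μ.up_left_mem le_rfl (Nat.zero_le _) h)).trans_le hμ

theorem Interlaces.colLen_truncate_le (h : Interlaces μ r) : (μ.truncate r).colLen 0 ≤ n := by
  by_contra hc
  obtain ⟨hi, -⟩ := h.mem_truncate.1 (YoungDiagram.mem_iff_lt_colLen.2 (not_le.1 hc))
  exact lt_irrefl _ hi

theorem Interlaces.strip (h : Interlaces μ r) (hμ : μ.colLen 0 ≤ n + 1) (i j : ℕ)
    (hc : (i + 1, j) ∈ μ) : (i, j) ∈ μ.truncate r := by
  have hi : i < n := Nat.lt_of_succ_lt_succ (lt_of_mem_of_colLen_le hμ hc)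
  exact h.mem_truncate.2 ⟨hi, (YoungDiagram.mem_iff_lt_rowLen.1 hc).trans_le (h.bounds ⟨i, hi⟩).1⟩

namespace BoundedSSYT

theorem exists_rowLen_le_or (T : BoundedSSYT μ (n + 1)) (i : ℕ) :
    ∃ j, μ.rowLen i ≤ j ∨ n ≤ T.1 i j := ⟨μ.rowLen i, Or.inl le_rfl⟩

/-- The number of entries less than `n` in the `i`th row. -/
noncomputable def innerRowLen (T : BoundedSSYT μ (n + 1)) (i : Fin n) : ℕ :=
  Nat.find (T.exists_rowLen_le_or i)

theorem lt_innerRowLen_iff (T : BoundedSSYT μ (n + 1)) (i : Fin n) (j : ℕ) :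
    j < T.innerRowLen i ↔ (↑i, j) ∈ μ ∧ T.1 i j < n := by
  rw [innerRowLen, Nat.lt_find_iff]
  constructor
  · intro h
    have := h j le_rfl
    push Not at this
    exact ⟨YoungDiagram.mem_iff_lt_rowLen.2 this.1, this.2⟩
  · rintro ⟨h1, h2⟩ j' hj'
    push Not
    exact ⟨hj'.trans_lt (YoungDiagram.mem_iff_lt_rowLen.1 h1),
      (T.1.row_weak_of_le hj' h1).trans_lt h2⟩

theorem interlaces_innerRowLen (T : BoundedSSYT μ (n + 1)) : Interlaces μ T.innerRowLen := by
  rw [Interlaces, Fintype.mem_piFinset]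
  intro i
  rw [Finset.mem_Icc]
  constructor
  · refine le_of_forall_lt fun j hj => ?_
    have hc := YoungDiagram.mem_iff_lt_rowLen.2 hj
    rw [lt_innerRowLen_iff]
    exact ⟨μ.up_left_mem (Nat.le_succ _) le_rfl hc,
      (T.1.col_strict (Nat.lt_succ_self _) hc).trans_le (Nat.lt_succ_iff.1 (T.2 _ _ hc))⟩
  · refine le_of_forall_lt fun j hj => ?_
    exact YoungDiagram.mem_iff_lt_rowLen.1 ((T.lt_innerRowLen_iff i j).1 hj).1

theorem mem_truncate_innerRowLen (T : BoundedSSYT μ (n + 1)) {i j : ℕ} :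
    (i, j) ∈ μ.truncate T.innerRowLen ↔ (i, j) ∈ μ ∧ T.1 i j < n := by
  rw [T.interlaces_innerRowLen.mem_truncate]
  constructor
  · rintro ⟨hi, hj⟩
    exact (T.lt_innerRowLen_iff ⟨i, hi⟩ j).1 hj
  · rintro ⟨h1, h2⟩
    have hi : i < n := by
      refine lt_of_le_of_lt ?_ h2
      clear h2
      induction i with
      | zero => exact Nat.zero_le _
      | succ i ih =>
        exact (ih (μ.up_left_mem (Nat.le_succ _) le_rfl h1)).trans_lt
          (T.1.col_strict (Nat.lt_succ_self _) h1)
    exact ⟨hi, (T.lt_innerRowLen_iff ⟨i, hi⟩ j).2 ⟨h1, h2⟩⟩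

/-- The subtableau of the entries less than `n`. -/
noncomputable def inner (T : BoundedSSYT μ (n + 1)) (r : Fin n → ℕ)
    (h : T.innerRowLen = r) : BoundedSSYT (μ.truncate r) n :=
  ⟨T.1.restrict (μ.truncate_le r), fun i j hc => by
    subst h
    exact (if_pos hc).trans_lt (T.mem_truncate_innerRowLen.1 hc).2⟩

/-- The tableau obtained by adding entries `n`. -/
noncomputable def outer (hμ : μ.colLen 0 ≤ n + 1) (h : Interlaces μ r)
    (T : BoundedSSYT (μ.truncate r) n) : BoundedSSYT μ (n + 1) :=
  ⟨T.1.extend n (μ.truncate_le r) (h.strip hμ) T.2, fun i j hc => by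
    change (if (i, j) ∈ μ.truncate r then T.1 i j else if (i, j) ∈ μ then n else 0) < n + 1
    split_ifs with h1
    · exact (T.2 _ _ h1).trans (Nat.lt_succ_self n)
    · exact Nat.lt_succ_self n⟩

theorem outer_apply (hμ : μ.colLen 0 ≤ n + 1) (h : Interlaces μ r)
    (T : BoundedSSYT (μ.truncate r) n) (i j : ℕ) : (T.outer hμ h).1 i j =
      if (i, j) ∈ μ.truncate r then T.1 i j else if (i, j) ∈ μ then n else 0 := rfl

theorem inner_apply (T : BoundedSSYT μ (n + 1)) (h : T.innerRowLen = r) (i j : ℕ) :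
    (T.inner r h).1 i j = if (i, j) ∈ μ.truncate r then T.1 i j else 0 := rfl

theorem innerRowLen_outer (hμ : μ.colLen 0 ≤ n + 1) (h : Interlaces μ r)
    (T : BoundedSSYT (μ.truncate r) n) : (T.outer hμ h).innerRowLen = r := by
  ext i
  refine eq_of_forall_lt_iff fun j => ?_
  rw [lt_innerRowLen_iff, outer_apply, ← h.rowLen_truncate i, ← YoungDiagram.mem_iff_lt_rowLen]
  constructor
  · rintro ⟨h1, h2⟩
    by_contra h3
    rw [if_neg h3, if_pos h1] at h2
    exact lt_irrefl _ h2
  · intro h1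
    rw [if_pos h1]
    exact ⟨μ.truncate_le r h1, T.2 _ _ h1⟩

end BoundedSSYT

variable {R : Type*} [CommRing R]

/-- The contribution of a tableau to the factorial Schur function, for a sequence of variables. -/
def tableauWeight (z α : ℕ → R) (μ : YoungDiagram) (T : ℕ → ℕ → ℕ) : R :=
  ∏ x ∈ μ.cells, (z (T x.1 x.2) + α (T x.1 x.2 + x.2 + 1 - x.1))

theorem tableauWeight_eq_mul (z α : ℕ → R) (hμ : μ.colLen 0 ≤ n + 1) (h : Interlaces μ r)
    (T : BoundedSSYT μ (n + 1)) (hT : T.innerRowLen = r) :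
    tableauWeight z α μ T.1 = (facPow (z n) α (μ.rowLen n) *
      ∏ i : Fin n, ∏ c ∈ Finset.Ico (r i) (μ.rowLen i), (z n + α (n + c + 1 - i))) *
        tableauWeight z α (μ.truncate r) (T.inner r hT).1 := by
  rw [tableauWeight, ← Finset.prod_sdiff (YoungDiagram.cells_subset_iff.2 (μ.truncate_le r))]
  congr 1
  · let r' : ℕ → ℕ := fun i => if hi : i < n then r ⟨i, hi⟩ else 0
    have hmem : ∀ x : ℕ × ℕ, x ∈ μ.cells \ (μ.truncate r).cells ↔
        x.1 ∈ Finset.range (n + 1) ∧ x.2 ∈ Finset.Ico (r' x.1) (μ.rowLen x.1) := by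
      rintro ⟨i, j⟩
      rw [Finset.mem_sdiff, YoungDiagram.mem_cells, YoungDiagram.mem_cells, h.mem_truncate,
        Finset.mem_Ico, ← YoungDiagram.mem_iff_lt_rowLen, Finset.mem_range]
      constructor
      · rintro ⟨h1, h2⟩
        refine ⟨lt_of_mem_of_colLen_le hμ h1, ?_, h1⟩
        by_cases hi : i < n
        · simpa [r', hi] using h2
        · simp [r', hi]
      · rintro ⟨-, h2, h1⟩
        refine ⟨h1, ?_⟩
        rintro ⟨hi, h3⟩
        simp only [r', hi, dif_pos] at h2
        omega
    have hval : ∀ x ∈ μ.cells \ (μ.truncate r).cells,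
        z (T.1 x.1 x.2) + α (T.1 x.1 x.2 + x.2 + 1 - x.1) = z n + α (n + x.2 + 1 - x.1) := by
      rintro ⟨i, j⟩ hx
      rw [Finset.mem_sdiff, YoungDiagram.mem_cells, YoungDiagram.mem_cells, ← hT,
        T.mem_truncate_innerRowLen] at hx
      have h1 := T.2 _ _ hx.1
      have h2 : T.1 i j = n := by
        have : ¬T.1 i j < n := fun h3 => hx.2 ⟨hx.1, h3⟩
        omega
      rw [h2]
    rw [Finset.prod_congr rfl hval,
      Finset.prod_finset_product' _ (Finset.range (n + 1))
        (fun i => Finset.Ico (r' i) (μ.rowLen i)) hmem (f := fun i c => z n + α (n + c + 1 - i)),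
      Finset.prod_range_succ, mul_comm, Finset.prod_range]
    congr 1
    · simp only [r', lt_irrefl, dif_neg, not_false_iff, Nat.Ico_zero_eq_range, facPow]
      refine Finset.prod_congr rfl fun c _ => ?_
      congr 2
      omega
    · refine Finset.prod_congr rfl fun i _ => ?_
      simp [r']
  · refine Finset.prod_congr rfl fun x hx => ?_
    rw [BoundedSSYT.inner_apply, if_pos ((YoungDiagram.mem_cells _).1 hx)]

theorem sum_tableauWeight_fiber (z α : ℕ → R) (hμ : μ.colLen 0 ≤ n + 1) (h : Interlaces μ r) :
    ∑ T : BoundedSSYT μ (n + 1) with T.innerRowLen = r, tableauWeight z α μ T.1 =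
      (facPow (z n) α (μ.rowLen n) *
        ∏ i : Fin n, ∏ c ∈ Finset.Ico (r i) (μ.rowLen i), (z n + α (n + c + 1 - i))) *
          ∑ T : BoundedSSYT (μ.truncate r) n, tableauWeight z α (μ.truncate r) T.1 := by
  rw [Finset.mul_sum]
  refine Finset.sum_bij' (fun T hT => T.inner r (Finset.mem_filter.1 hT).2)
    (fun T _ => T.outer hμ h) (fun _ _ => Finset.mem_univ _)
    (fun T _ => Finset.mem_filter.2 ⟨Finset.mem_univ _, T.innerRowLen_outer hμ h⟩) ?_ ?_ ?_
  · intro T hT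
    have hT := (Finset.mem_filter.1 hT).2
    apply Subtype.ext
    ext i j
    rw [BoundedSSYT.outer_apply, BoundedSSYT.inner_apply]
    by_cases h1 : (i, j) ∈ μ.truncate r
    · rw [if_pos h1, if_pos h1]
    · rw [if_neg h1]
      split_ifs with h2
      · rw [← hT, T.mem_truncate_innerRowLen] at h1
        have h3 := T.2 _ _ h2
        have : ¬T.1 i j < n := fun h4 => h1 ⟨h2, h4⟩
        omega
      · exact (T.1.zeros h2).symm
  · intro T _
    apply Subtype.ext
    ext i j
    rw [BoundedSSYT.inner_apply, BoundedSSYT.outer_apply]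
    split_ifs with h1
    · rfl
    · exact (T.1.zeros h1).symm
  · intro T hT
    exact tableauWeight_eq_mul z α hμ h T _

theorem sum_tableauWeight_eq_det (z α : ℕ → R) (n : ℕ) (μ : YoungDiagram) (hμ : μ.colLen 0 ≤ n) :
    ∑ T : BoundedSSYT μ n, tableauWeight z α μ T.1 =
      Matrix.det (Matrix.of fun i j =>
        jtRow α n (fun i => z i) i (shiftedPart μ n j)) := by
  induction n generalizing μ with
  | zero =>
    have hc : ∀ i j, (i, j) ∉ μ := fun i j h => Nat.not_lt_zero _ (lt_of_mem_of_colLen_le hμ h)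
    have hcells : μ.cells = ∅ := Finset.eq_empty_of_forall_notMem fun x hx =>
      hc _ _ ((YoungDiagram.mem_cells _).1 hx)
    let T₀ : BoundedSSYT μ 0 :=
      ⟨SemistandardYoungTableau.highestWeight μ, fun i j h => absurd h (hc i j)⟩
    rw [Fintype.sum_eq_single T₀]
    · simp [tableauWeight, hcells]
    · intro T hT
      refine absurd (Subtype.ext ?_) hT
      ext i j
      rw [T.1.zeros (hc i j), T₀.1.zeros (hc i j)]
  | succ n ih =>
    rw [det_jtRow_succ, Finset.mul_sum,
      ← Finset.sum_fiberwise_of_maps_to fun T _ => BoundedSSYT.interlaces_innerRowLen T]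
    refine Finset.sum_congr rfl fun r hr => ?_
    have hr : Interlaces μ r := hr
    rw [sum_tableauWeight_fiber z α hμ hr, ih _ hr.colLen_truncate_le, mul_assoc]
    simp only [shiftedPart, hr.rowLen_truncate]
    rfl

theorem factorialSchur_eq_det (hμ : μ.colLen 0 ≤ n) (z : Fin n → R) (α : ℕ → R) :
    factorialSchur μ z α =
      Matrix.det (Matrix.of fun i j => jtRow α n z i (shiftedPart μ n j)) := by
  let z' : ℕ → R := fun a => if h : a < n then z ⟨a, h⟩ else 0
  have hz : (fun i : Fin n => z' i) = z := by
    ext i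
    simp [z']
  have := sum_tableauWeight_eq_det z' α n μ hμ
  rw [hz] at this
  rw [← this, factorialSchur]
  refine Finset.sum_congr rfl fun T _ => ?_
  refine Eq.trans ?_ (Finset.prod_coe_sort μ.cells fun x : ℕ × ℕ =>
    z' (T.1 x.1 x.2) + α (T.1 x.1 x.2 + x.2 + 1 - x.1))
  refine Finset.prod_congr rfl fun c _ => ?_
  congr 1
  exact (congrFun hz (T.entry c)).symm

end Tableaux

theorem mainTheorem6 {R : Type*} [CommRing R] (n : ℕ) (μ : YoungDiagram)
    (hμ : μ.colLen 0 ≤ n) (t : R) (z : Fin n → R) (α : ℕ → R) :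
    partitionFunction μ n t z α =
      (∏ i : Fin n, ∏ j ∈ Finset.Ioi i, (t * z i + z j)) * factorialSchur μ z α := by
  rw [partitionFunction_eq_latticeSum, latticeSum_eq,
    spinDet_of_downs_eq _ (downs_bottomSpin μ le_rfl), factorialSchur_eq_det hμ]
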